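/- Let $k$ be an algebraically closed field and let $n\ge 1$. Let $Q$ be a quiver with $n$ vertices, labelled $1,\dots,n$, such that there are no arrows $i\to j$ when $i<j$ (loops are allowed). Let $A=kQ/I$ with $I$ an admissible ideal of the path algebra, that is, $J^m\subseteq I\subseteq J^2$ for some $m\ge 2$, where $J$ is the ideal generated by the arrows; paths are composed like functions. Let $B$ be a subalgebra of $A$ that is conjugate by a unit of $A$ to a unital subalgebra of $A$ generated by the elements (vertices and arrows) of a quiver $R$ inside $A$ with the following properties: * each vertex of $R$ is a sum of (distinct) vertices of $Q$; * each arrow $\beta$ of $R$ satisfies $\beta=f\beta e$ for some vertices $e,f$ of $Q$; * $R$ contains every loop of $Q$ (as an arrow). Let $A^e=A\otimes_k A^{op}$ be the enveloping algebra of $A$, and regard $B^e=B\otimes_k B^{op}$ as a subalgebra of it. Then the left relative global dimension satisfies $$\operatorname{gldim}(A^e,B^e)\le 2n-2 .$$ Here, for a subalgebra $D\subseteq C$, a left $C$-module $M$ is called $(C,D)$-projective if every $C$-module homomorphism onto $M$ that splits over $D$ splits over $C$; the relative projective dimension of a left $C$-module $M$ is the least $m$ for which there is an exact sequence of $C$-modules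 $0\to P_m\to\cdots\to P_0\to M\to 0$ with every $P_i$ being $(C,D)$-projective and with the kernel of each map a direct summand as a $D$-module ($\infty$ if there is none); and $\operatorname{gldim}(C,D)$ is the supremum of the relative projective dimensions of all left $C$-modules. -/

import Mathlib

open scoped TensorProduct

universe u u₁ u₂ v w

noncomputable section

/-! ## The path algebra of a quiver with finitely many vertices -/

/-- A path of the quiver `V`, together with its start and end vertices. The stationary path at a
vertex is the path of length `0`. -/
structure QuiverPath (V : Type u₁) [Quiver.{v} V] where
  src : V
  tgt : V
  path : Quiver.Path src tgt

/-- The path algebra `kQ`: the vector space with basis the paths of the quiver. -/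
def PathAlgebra (k : Type u) (V : Type u₁) [Field k] [Quiver.{v} V] : Type (max u u₁ v) :=
  QuiverPath V →₀ k

namespace PathAlgebra

variable {k : Type u} {V : Type u₁} [Field k] [Quiver.{v} V]

instance : AddCommGroup (PathAlgebra k V) := inferInstanceAs (AddCommGroup (QuiverPath V →₀ k))

instance : Module k (PathAlgebra k V) := inferInstanceAs (Module k (QuiverPath V →₀ k))

/-- The basis element of `kQ` given by a path. -/
def ofPath (p : QuiverPath V) : PathAlgebra k V := (Finsupp.single p 1 : QuiverPath V →₀ k)

open Classical in
/-- The product `pq` of two paths: first `q`, then `p` (paths are composed like functions) if `q`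
ends where `p` starts, and `0` otherwise. -/
def pathMul (p q : QuiverPath V) : PathAlgebra k V :=
  if h : p.src = q.tgt then ofPath ⟨q.src, p.tgt, q.path.comp (p.path.cast h rfl)⟩ else 0

/-- The bilinear extension of the product of paths. -/
def mulLin : PathAlgebra k V →ₗ[k] PathAlgebra k V →ₗ[k] PathAlgebra k V :=
  Finsupp.linearCombination k fun p : QuiverPath V =>
    (Finsupp.linearCombination k fun q : QuiverPath V => (pathMul p q : PathAlgebra k V) :
      (QuiverPath V →₀ k) →ₗ[k] PathAlgebra k V)

instance : Mul (PathAlgebra k V) := ⟨fun f g => mulLin f g⟩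

theorem mul_def (f g : PathAlgebra k V) : f * g = mulLin f g := rfl

theorem ofPath_mul_ofPath (p q : QuiverPath V) :
    (ofPath p * ofPath q : PathAlgebra k V) = pathMul p q := by
  rw [mul_def]
  unfold mulLin ofPath
  erw [Finsupp.linearCombination_single, one_smul, Finsupp.linearCombination_single, one_smul]

/-- The stationary path at a vertex, as an element of `kQ`. -/
def vertex (x : V) : PathAlgebra k V := ofPath ⟨x, x, Quiver.Path.nil⟩

/-- An arrow, as an element of `kQ`. -/
def arrow {x y : V} (a : x ⟶ y) : PathAlgebra k V := ofPath ⟨x, y, a.toPath⟩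

theorem induction_on {P : PathAlgebra k V → Prop} (f : PathAlgebra k V) (h0 : P 0)
    (hadd : ∀ f g, P f → P g → P (f + g)) (hsmul : ∀ (c : k) p, P (c • ofPath p)) : P f := by
  refine Finsupp.induction_linear (motive := P) f h0 hadd fun p c => ?_
  have : (Finsupp.single p c : QuiverPath V →₀ k) = c • Finsupp.single p (1 : k) := by simp
  rw [this]
  exact hsmul c p

theorem pathMul_assoc (p q r : QuiverPath V) :
    (mulLin (pathMul p q) (ofPath r) : PathAlgebra k V) =
      mulLin (ofPath p) (pathMul q r) := by
  obtain ⟨a, b, p⟩ := p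
  obtain ⟨c, d, q⟩ := q
  obtain ⟨e, f, r⟩ := r
  by_cases h₁ : a = d
  · subst h₁
    by_cases h₂ : c = f
    · subst h₂
      simp [pathMul, ← mul_def, ofPath_mul_ofPath, Quiver.Path.comp_assoc]
    · simp [pathMul, ← mul_def, ofPath_mul_ofPath, h₂]
      simp [mul_def]
  · by_cases h₂ : c = f
    · subst h₂
      simp [pathMul, ← mul_def, ofPath_mul_ofPath, h₁]
    · simp [pathMul, h₁, h₂]

theorem mul_assoc' (f g h : PathAlgebra k V) : f * g * h = f * (g * h) := by
  simp only [mul_def]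
  induction f using induction_on with
  | h0 => simp
  | hadd f₁ f₂ h₁ h₂ => simp [h₁, h₂]
  | hsmul c p =>
    induction g using induction_on with
    | h0 => simp
    | hadd f₁ f₂ h₁ h₂ => simp only [map_add, LinearMap.add_apply, h₁, h₂]
    | hsmul d q =>
      induction h using induction_on with
      | h0 => simp
      | hadd f₁ f₂ h₁ h₂ => simp only [map_add, h₁, h₂]
      | hsmul e r =>
        simp only [map_smul, LinearMap.smul_apply]
        have := pathMul_assoc (k := k) p q r
        simp only [← mul_def, ofPath_mul_ofPath] at this ⊢
        rw [this]

variable [Fintype V]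

/-- The unit of `kQ` is the sum of the stationary paths. -/
instance : One (PathAlgebra k V) := ⟨∑ x : V, vertex x⟩

theorem one_def : (1 : PathAlgebra k V) = ∑ x : V, vertex x := rfl

theorem one_mul' (f : PathAlgebra k V) : 1 * f = f := by
  rw [mul_def, one_def]
  induction f using induction_on with
  | h0 => simp
  | hadd f₁ f₂ h₁ h₂ => rw [map_add, h₁, h₂]
  | hsmul c p =>
    obtain ⟨a, b, p⟩ := p
    rw [map_smul, map_sum, LinearMap.sum_apply]
    congr 1
    rw [Finset.sum_eq_single b]
    · simp [← mul_def, vertex, ofPath_mul_ofPath, pathMul]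
    · intro x _ hx
      simp [← mul_def, vertex, ofPath_mul_ofPath, pathMul, hx]
    · simp

theorem mul_one' (f : PathAlgebra k V) : f * 1 = f := by
  rw [mul_def, one_def]
  induction f using induction_on with
  | h0 => simp
  | hadd f₁ f₂ h₁ h₂ => rw [map_add, LinearMap.add_apply, h₁, h₂]
  | hsmul c p =>
    obtain ⟨a, b, p⟩ := p
    rw [map_smul, LinearMap.smul_apply, map_sum]
    congr 1
    rw [Finset.sum_eq_single a]
    · simp [← mul_def, vertex, ofPath_mul_ofPath, pathMul]
    · intro x _ hx
      simp [← mul_def, vertex, ofPath_mul_ofPath, pathMul, Ne.symm hx]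
    · simp

instance : Ring (PathAlgebra k V) :=
  { (inferInstance : AddCommGroup (PathAlgebra k V)) with
    mul := fun f g => f * g
    one := 1
    left_distrib := fun f g h => by
      change mulLin f (g + h) = mulLin f g + mulLin f h
      rw [map_add]
    right_distrib := fun f g h => by
      change mulLin (f + g) h = mulLin f h + mulLin g h
      rw [map_add, LinearMap.add_apply]
    zero_mul := fun f => by
      change mulLin 0 f = 0
      rw [map_zero, LinearMap.zero_apply]
    mul_zero := fun f => by
      change mulLin f 0 = 0
      rw [map_zero]
    mul_assoc := mul_assoc'
    one_mul := one_mul'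
    mul_one := mul_one' }

instance : Algebra k (PathAlgebra k V) :=
  Algebra.ofModule
    (fun c f g => by
      change mulLin (c • f) g = c • mulLin f g
      rw [map_smul, LinearMap.smul_apply])
    (fun c f g => by
      change mulLin f (c • g) = c • mulLin f g
      rw [map_smul])

variable (k V) in
/-- The arrow ideal of `kQ`: the span of the paths of length at least one. -/
def arrowIdeal : Submodule k (PathAlgebra k V) :=
  Submodule.span k (ofPath '' {p : QuiverPath V | 1 ≤ p.path.length})

/-- An ideal `I` of `kQ` is admissible if `J ^ m ⊆ I ⊆ J ^ 2` for some `m ≥ 2`, where `J` is the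
arrow ideal. -/
def IsAdmissible (I : TwoSidedIdeal (PathAlgebra k V)) : Prop :=
  (∃ m : ℕ, 2 ≤ m ∧ ∀ a ∈ arrowIdeal k V ^ m, a ∈ I) ∧ ∀ a ∈ I, a ∈ arrowIdeal k V ^ 2

/-- The quotient algebra `kQ/I`. -/
abbrev Bound (I : TwoSidedIdeal (PathAlgebra k V)) : Type (max u u₁ v) := I.ringCon.Quotient

/-- The image in `kQ/I` of a vertex of `Q`. -/
def boundVertex (I : TwoSidedIdeal (PathAlgebra k V)) (x : V) : Bound I :=
  I.ringCon.mk' (vertex x)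

/-- The image in `kQ/I` of an arrow of `Q`. -/
def boundArrow (I : TwoSidedIdeal (PathAlgebra k V)) {x y : V} (a : x ⟶ y) : Bound I :=
  I.ringCon.mk' (arrow a)

end PathAlgebra

/-! ## Subalgebras -/

section Subalgebras

variable {k : Type u} [Field k]

/-- `B` is conjugate to `C`: there is a unit `z` with `B = z C z⁻¹`. -/
def Subalgebra.IsConjugateTo {A : Type u₁} [Ring A] [Algebra k A] (B C : Subalgebra k A) : Prop :=
  ∃ z : Aˣ, ∀ b : A, b ∈ B ↔ ∃ c ∈ C, b = ↑z * c * ↑z⁻¹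

/-- The enveloping algebra `A ⊗ Aᵒᵖ` of `A`. -/
abbrev Enveloping (k : Type u) [Field k] (A : Type u₁) [Ring A] [Algebra k A] : Type u₁ :=
  A ⊗[k] Aᵐᵒᵖ

/-- The enveloping algebra of the subalgebra `B` of `A`, as a subalgebra of the enveloping algebra
of `A`: the image of the (injective) map `B ⊗ Bᵒᵖ → A ⊗ Aᵒᵖ`. -/
def Subalgebra.enveloping {A : Type u₁} [Ring A] [Algebra k A] (B : Subalgebra k A) :
    Subalgebra k (Enveloping k A) :=
  (Algebra.TensorProduct.map B.val B.op.val).range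

/-- The vertices and the arrows of a quiver `R` inside the algebra `A`. Only the elements of `A`
are recorded, since the subalgebra that they generate depends on nothing else. -/
structure QuiverElements (A : Type u₁) where
  vertices : Set A
  arrows : Set A

/-- The (unital) subalgebra of `A` generated by the elements of a quiver. -/
def QuiverElements.subalgebra (k : Type u) [Field k] {A : Type u₁} [Ring A] [Algebra k A]
    (R : QuiverElements A) : Subalgebra k A :=
  Algebra.adjoin k (R.vertices ∪ R.arrows)

end Subalgebras

/-- The conditions on the quiver `R` inside `A = kQ/I`: the vertices of `R` are sums of (distinct)
vertices of `Q`, every arrow `β` of `R` satisfies `β = f β e` for some vertices `e`, `f` of `Q`,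
and every loop of `Q` is an arrow of `R`. -/
structure QuiverElements.IsCompatible {k : Type u} {V : Type u₁} [Field k] [Quiver.{v} V]
    [Fintype V] {I : TwoSidedIdeal (PathAlgebra k V)}
    (R : QuiverElements (PathAlgebra.Bound I)) : Prop where
  vertices_eq : ∀ r ∈ R.vertices, ∃ S : Finset V, r = ∑ x ∈ S, PathAlgebra.boundVertex I x
  arrows_eq : ∀ β ∈ R.arrows, ∃ e f : V,
    β = PathAlgebra.boundVertex I f * β * PathAlgebra.boundVertex I e
  loops_mem : ∀ (x : V) (a : x ⟶ x), PathAlgebra.boundArrow I a ∈ R.arrows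

/-! ## Relative homological algebra of an extension `B ⊆ A` -/

section Relative

variable {k : Type u} {A : Type u₁} [Field k] [Ring A] [Algebra k A]

/-- `M` is `(A, B)`-projective: every homomorphism of `A`-modules onto `M` that splits as a
homomorphism of `B`-modules splits as a homomorphism of `A`-modules. The modules range over a
universe `w`, which is meant to be at least the universe of `A`. -/
def IsRelProjective (B : Subalgebra k A) (M : ModuleCat.{w} A) : Prop :=
  ∀ (N : ModuleCat.{w} A) (f : N →ₗ[A] M), Function.Surjective f →
    (∃ s : M →ₗ[B] N, ∀ m, f (s m) = m) → ∃ t : M →ₗ[A] N, ∀ m, f (t m) = m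

/-- The submodule `K` of the `A`-module `M` is a direct summand of `M` as a `B`-module. -/
def IsRelSummand (B : Subalgebra k A) {M : ModuleCat.{w} A} (K : Submodule A M) : Prop :=
  ∃ C : Submodule B M, IsCompl (K.restrictScalars B) C

/-- There is an `(A, B)`-exact sequence `0 → Pₙ → ⋯ → P₁ → P₀ → M → 0` with all `Pᵢ` being
`(A, B)`-projective. The sequence is continued by `Pᵢ = 0` for `i > n`. -/
def HasRelResolution (B : Subalgebra k A) (M : ModuleCat.{w} A) (n : ℕ) : Prop :=
  ∃ (P : ℕ → ModuleCat.{w} A) (d : ∀ i, P (i + 1) →ₗ[A] P i) (ε : P 0 →ₗ[A] M),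
    (∀ i ≤ n, IsRelProjective B (P i)) ∧ (∀ i, n < i → Subsingleton (P i)) ∧
    Function.Surjective ε ∧ LinearMap.range (d 0) = LinearMap.ker ε ∧
    (∀ i, LinearMap.range (d (i + 1)) = LinearMap.ker (d i)) ∧
    IsRelSummand B (LinearMap.ker ε) ∧ ∀ i, IsRelSummand B (LinearMap.ker (d i))

/-- The relative projective dimension `pd_{(A, B)} M`. -/
def relProjDim (B : Subalgebra k A) (M : ModuleCat.{w} A) : ℕ∞ :=
  ⨅ (n : ℕ) (_ : HasRelResolution B M n), (n : ℕ∞)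

/-- The (left) relative global dimension `gldim(A, B)`: the supremum of the relative projective
dimensions of the left `A`-modules (in the universe `w`). -/
def relGlobalDim (B : Subalgebra k A) : ℕ∞ :=
  ⨆ M : ModuleCat.{w} A, relProjDim B M

end Relative

end

/-! ### Relative resolutions: change of subalgebra and splicing -/

section RelativeResolutions

variable {k : Type u} {T : Type u₁} [Field k] [Ring T] [Algebra k T]

/-! Arrows never raise labels, so `A` is triangular with respect to its vertices. Hence `A ⊗ Aᵒᵖ` is
triangular with respect to the idempotents `e_x ⊗ e_y`, which fall into `2n - 1` levels. Enlarge `B`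
to the algebra `C` generated by all vertices and the arrows of `R` (conjugated as `B` is). Cycles at
a vertex are products of loops, so `C` contains the corners `e_x A e_x`, and its enveloping algebra
contains all diagonal corners of `A ⊗ Aᵒᵖ`.

Two arguments finish the proof. Relative to a subalgebra containing the diagonal corners, the kernel
of `T ⊗_S M → M` lives on one level fewer than `M`, so induction gives resolutions of length at most
`2n - 2` (`hasRelResolution_of_triangular`). Passing from `C` down to `B` preserves relative
projectivity: a section linear over the enveloping algebra of `B` becomes linear over that of `C`
once `s` is replaced by `∑ ε s ε` (`IsRelProjective.of_homogeneous_generators`), because `C` only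
adds idempotents to homogeneous elements of `B`. -/

theorem isRelSummand_ker_of_section (S : Subalgebra k T) {M N : ModuleCat.{w} T} (f : M →ₗ[T] N)
    (s : N →ₗ[S] M) (hs : ∀ x, f (s x) = x) : IsRelSummand S (LinearMap.ker f) := by
  refine ⟨LinearMap.range s, ?_, ?_⟩
  · rw [Submodule.disjoint_def]
    rintro _ hx ⟨y, rfl⟩
    have : y = 0 := by simpa [hs] using hx
    simp [this]
  · rw [codisjoint_iff, eq_top_iff]
    rintro x -
    refine Submodule.mem_sup.2 ⟨x - s (f x), ?_, s (f x), ⟨_, rfl⟩, by simp⟩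
    simp [hs]

theorem isRelSummand_bot (S : Subalgebra k T) {M : ModuleCat.{w} T} :
    IsRelSummand S (⊥ : Submodule T M) :=
  ⟨⊤, by simpa using isCompl_bot_top⟩

theorem IsRelSummand.mono {S S' : Subalgebra k T} (h : S' ≤ S) {M : ModuleCat.{w} T}
    {K : Submodule T M} (hK : IsRelSummand S K) : IsRelSummand S' K := by
  obtain ⟨C, h₁, h₂⟩ := hK
  let C' : Submodule S' M :=
    { carrier := C
      add_mem' := C.add_mem
      zero_mem' := C.zero_mem
      smul_mem' := fun c _ hx => C.smul_mem (⟨c, h c.2⟩ : S) hx }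
  refine ⟨C', ?_, ?_⟩
  · rw [Submodule.disjoint_def] at h₁ ⊢
    exact h₁
  · rw [codisjoint_iff, eq_top_iff] at h₂ ⊢
    rintro x -
    obtain ⟨y, hy, z, hz, rfl⟩ := Submodule.mem_sup.1 (h₂ (Submodule.mem_top (x := x)))
    exact Submodule.mem_sup.2 ⟨y, hy, z, hz, rfl⟩

/-- A relative resolution over `S` is a relative resolution over a smaller subalgebra `S'` as soon
as relative projectivity over `S` implies relative projectivity over `S'`. -/
theorem HasRelResolution.mono {S S' : Subalgebra k T} (h : S' ≤ S)
    (hproj : ∀ P : ModuleCat.{w} T, IsRelProjective S P → IsRelProjective S' P)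
    {M : ModuleCat.{w} T} {n : ℕ} (hM : HasRelResolution S M n) : HasRelResolution S' M n := by
  obtain ⟨P, d, ε, h₁, h₂, h₃, h₄, h₅, h₆, h₇⟩ := hM
  exact ⟨P, d, ε, fun i hi => hproj _ (h₁ i hi), h₂, h₃, h₄, h₅, h₆.mono h, fun i => (h₇ i).mono h⟩

theorem IsRelProjective.hasRelResolution_zero {S : Subalgebra k T} {M : ModuleCat.{w} T}
    (hM : IsRelProjective S M) : HasRelResolution S M 0 := by
  refine ⟨fun i => Nat.casesOn i M fun _ => ModuleCat.of T PUnit, fun _ => 0, LinearMap.id,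
    ?_, ?_, Function.surjective_id, ?_, ?_, ?_, ?_⟩
  · intro i hi
    obtain rfl : i = 0 := by omega
    exact hM
  · rintro (_ | i) hi
    · omega
    · exact inferInstanceAs (Subsingleton PUnit)
  · rw [LinearMap.range_zero]
    exact LinearMap.ker_id.symm
  · intro i
    have : Subsingleton (Submodule T (ModuleCat.of T PUnit.{w + 1})) :=
      inferInstanceAs (Subsingleton (Submodule T PUnit.{w + 1}))
    exact Subsingleton.elim (α := Submodule T (ModuleCat.of T PUnit.{w + 1})) _ _
  · have : LinearMap.ker (LinearMap.id : M →ₗ[T] M) = ⊥ := LinearMap.ker_id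
    exact this ▸ isRelSummand_bot S
  · intro i
    refine ⟨⊥, ?_⟩
    rw [LinearMap.ker_zero, Submodule.restrictScalars_top]
    exact isCompl_top_bot

/-- Splicing a relative resolution of a kernel with a relatively split epimorphism from a
relatively projective module. -/
theorem HasRelResolution.succ {S : Subalgebra k T} {M F : ModuleCat.{w} T} (f : F →ₗ[T] M)
    (hf : Function.Surjective f) (hF : IsRelProjective S F) (hs : IsRelSummand S (LinearMap.ker f))
    {n : ℕ} (hK : HasRelResolution S (ModuleCat.of T (LinearMap.ker f)) n) :
    HasRelResolution S M (n + 1) := by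
  obtain ⟨P, d, ε, h₁, h₂, h₃, h₄, h₅, h₆, h₇⟩ := hK
  have hker : LinearMap.ker ((LinearMap.ker f).subtype.comp ε) = LinearMap.ker ε :=
    LinearMap.ker_comp_of_ker_eq_bot _ (Submodule.ker_subtype _)
  refine ⟨fun i => Nat.casesOn i F P,
    fun i => Nat.casesOn i ((LinearMap.ker f).subtype.comp ε) d, f, ?_, ?_, hf, ?_, ?_, hs, ?_⟩
  · rintro (_ | i) hi
    · exact hF
    · exact h₁ i (by omega)
  · rintro (_ | i) hi
    · omega
    · exact h₂ i (by omega)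
  · change LinearMap.range ((LinearMap.ker f).subtype.comp ε) = _
    rw [LinearMap.range_comp_of_range_eq_top _ (LinearMap.range_eq_top.2 h₃),
      Submodule.range_subtype]
  · rintro (_ | i)
    · exact h₄.trans hker.symm
    · exact h₅ i
  · rintro (_ | i)
    · exact hker ▸ h₆
    · exact h₇ i

end RelativeResolutions

/-! ### Induced modules and triangular algebras -/

section InducedModule

variable {k : Type u} {T : Type u₁} [Field k] [Ring T] [Algebra k T]

/-- The relations that turn the free `T`-module on the set `M` into the induced module. -/
noncomputable def inducedRelations (S : Subalgebra k T) (M : Type w) [AddCommGroup M] [Module T M] :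
    Submodule T (M →₀ T) :=
  Submodule.span T
    (Set.range (fun p : M × M =>
        Finsupp.single (p.1 + p.2) 1 - (Finsupp.single p.1 1 + Finsupp.single p.2 1)) ∪
      Set.range fun p : S × M =>
        Finsupp.single ((p.1 : T) • p.2) 1 - Finsupp.single p.2 (p.1 : T))

/-- The induced module `T ⊗_S M` of the restriction to `S` of a `T`-module `M`. -/
abbrev InducedModule (S : Subalgebra k T) (M : Type w) [AddCommGroup M] [Module T M] :
    Type (max u₁ w) :=
  (M →₀ T) ⧸ inducedRelations S M

namespace InducedModule

variable (S : Subalgebra k T) (M : Type w) [AddCommGroup M] [Module T M]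

/-- The map `m ↦ 1 ⊗ m`. -/
noncomputable def ι : M →ₗ[S] InducedModule S M where
  toFun m := (inducedRelations S M).mkQ (Finsupp.single m 1)
  map_add' x y := by
    rw [← map_add, ← sub_eq_zero, ← map_sub]
    exact (Submodule.Quotient.mk_eq_zero _).2
      (Submodule.subset_span (Or.inl ⟨(x, y), rfl⟩))
  map_smul' c x := by
    have : (RingHom.id S c) • (inducedRelations S M).mkQ (Finsupp.single x 1) =
        (inducedRelations S M).mkQ (Finsupp.single x (c : T)) := by
      rw [RingHom.id_apply, Subalgebra.smul_def, ← map_smul, Finsupp.smul_single, smul_eq_mul,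
        mul_one]
    rw [this, ← sub_eq_zero, ← map_sub]
    exact (Submodule.Quotient.mk_eq_zero _).2
      (Submodule.subset_span (Or.inr ⟨(c, x), rfl⟩))

variable {S M}

theorem induction_on {p : InducedModule S M → Prop} (x : InducedModule S M) (h0 : p 0)
    (hadd : ∀ x y, p x → p y → p (x + y)) (hsmul : ∀ (t : T) (m : M), p (t • ι S M m)) : p x := by
  obtain ⟨x, rfl⟩ := (inducedRelations S M).mkQ_surjective x
  induction x using Finsupp.induction_linear with
  | zero => simpa using h0
  | add x y hx hy => rw [map_add]; exact hadd _ _ hx hy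
  | single m t =>
    have : (Finsupp.single m t : M →₀ T) = t • Finsupp.single m 1 := by simp
    rw [this, map_smul]
    exact hsmul t m

/-- The homomorphism of `T`-modules out of the induced module given by a homomorphism of
`S`-modules. -/
noncomputable def lift {N : Type u₂} [AddCommGroup N] [Module T N] (g : M →ₗ[S] N) :
    InducedModule S M →ₗ[T] N :=
  (inducedRelations S M).liftQ (Finsupp.linearCombination T g) <| by
    refine Submodule.span_le.2 ?_
    rintro _ (⟨⟨x, y⟩, rfl⟩ | ⟨⟨c, x⟩, rfl⟩)
    · simp
    · have := g.map_smul c x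
      simp only [Subalgebra.smul_def] at this
      simp [this]

theorem lift_ι {N : Type u₂} [AddCommGroup N] [Module T N] (g : M →ₗ[S] N) (m : M) :
    lift g (ι S M m) = g m := by
  refine ((inducedRelations S M).liftQ_apply _ _).trans ?_
  simp

-- By the universal property, an `S`-linear section `s` restricted along `ι` extends to a `T`-linear
-- map, which is a section because the elements `ι m` generate.
variable (S M) in
theorem isRelProjective :
    IsRelProjective S (ModuleCat.of.{max u₁ w} T (InducedModule S M)) := by
  rintro N f - ⟨s, hs⟩
  let s' : InducedModule S M →ₗ[S] N := s
  refine ⟨lift (s'.comp (ι S M)), fun x => ?_⟩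
  change f (lift (s'.comp (ι S M)) (x : InducedModule S M)) = (x : InducedModule S M)
  induction (x : InducedModule S M) using induction_on with
  | h0 => rw [map_zero, map_zero]
  | hadd x y hx hy => rw [map_add, map_add, hx, hy]
  | hsmul t m =>
    rw [map_smul, map_smul, lift_ι]
    exact congrArg (t • ·) (hs _)

variable (S M) in
/-- The multiplication map from the induced module to the module. -/
noncomputable def counit : InducedModule S M →ₗ[T] M := lift LinearMap.id

theorem counit_ι (m : M) : counit S M (ι S M m) = m := lift_ι _ _

end InducedModule

/-- If `T` is triangular with respect to `m + 1` orthogonal idempotents whose diagonal corners are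
contained in `S`, then a `T`-module on which all idempotents after the `b`-th vanish has relative
projective dimension at most `b`. -/
theorem hasRelResolution_of_triangular {m : ℕ} {η : Fin (m + 1) → T}
    (hη : CompleteOrthogonalIdempotents η) (S : Subalgebra k T)
    (htri : ∀ a b, b < a → ∀ t, η a * t * η b = 0) (hdiag : ∀ a t, η a * t * η a ∈ S)
    (b : ℕ) (M : ModuleCat.{max u₁ w} T)
    (hM : ∀ a : Fin (m + 1), b < a → ∀ x : M, η a • x = 0) : HasRelResolution S M b := by
  have hηS : ∀ a, η a ∈ S := fun a => by simpa [(hη.idem a).eq] using hdiag a 1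
  induction b generalizing M with
  | zero =>
    -- Only `η 0` acts nontrivially on `M`, and `T η₀ = η₀ T η₀` lies in `S`, so every `S`-linear
    -- section is already `T`-linear.
    refine IsRelProjective.hasRelResolution_zero ?_
    rintro N f - ⟨s, hs⟩
    have h0 : ∀ x : M, η 0 • x = x := fun x => by
      conv_rhs => rw [← one_smul T x, ← hη.complete, Finset.sum_smul]
      rw [Finset.sum_eq_single 0 _ (by simp)]
      exact fun a _ ha => hM a (Nat.pos_of_ne_zero fun h => ha (Fin.ext h)) x
    have hcol : ∀ t, η 0 * t * η 0 = t * η 0 := fun t => by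
      conv_rhs => rw [← one_mul t, ← hη.complete, Finset.sum_mul, Finset.sum_mul]
      rw [Finset.sum_eq_single 0 _ (by simp)]
      exact fun a _ ha => htri a 0 (Fin.pos_iff_ne_zero.2 ha) t
    refine ⟨{ s with map_smul' := fun t x => ?_ }, hs⟩
    have h1 := s.map_smul ⟨_, hdiag 0 t⟩ x
    have h2 := s.map_smul ⟨_, hηS 0⟩ x
    simp only [Subalgebra.smul_def, hcol, mul_smul, h0] at h1 h2
    change s (t • x) = t • s x
    rw [h1, ← h2]
  | succ b ih =>
    have hι : ∀ (d : Fin (m + 1)) (x : M),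
        η d • InducedModule.ι S M x = InducedModule.ι S M (η d • x) := fun d x =>
      ((InducedModule.ι S M).map_smul ⟨_, hηS d⟩ x).symm
    have hexp : ∀ (t : T) (x : M), t • InducedModule.ι S M x =
        ∑ d, (t * η d) • InducedModule.ι S M (η d • x) := fun t x => by
      conv_lhs => rw [← mul_one t, ← hη.complete, Finset.mul_sum, Finset.sum_smul]
      refine Finset.sum_congr rfl fun d _ => ?_
      rw [← hι, ← mul_smul, mul_assoc, (hη.idem d).eq]
    refine HasRelResolution.succ (F := ModuleCat.of.{max u₁ w} T (InducedModule S M))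
      (InducedModule.counit S M) (fun x => ⟨_, InducedModule.counit_ι x⟩)
      (InducedModule.isRelProjective S M)
      (isRelSummand_ker_of_section (M := ModuleCat.of.{max u₁ w} T (InducedModule S M)) S _
        (InducedModule.ι S M) InducedModule.counit_ι) (ih _ ?_)
    -- Above level `b` the induced module consists of elements `1 ⊗ y`. In `η a * t ⊗ x = ∑ η a * t
    -- * η d ⊗ η d x` the terms `d < a` vanish by triangularity and the terms `d > a` by `hM`; for
    -- `d = a` the coefficient lies in `S`. Since the counit is injective on such elements, its
    -- kernel vanishes above level `b`.
    have htop : ∀ a : Fin (m + 1), b < a → ∀ x : InducedModule S M,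
        ∃ y : M, η a • x = InducedModule.ι S M y := by
      intro a ha x
      induction x using InducedModule.induction_on with
      | h0 => exact ⟨0, by rw [smul_zero, map_zero]⟩
      | hadd x y hx hy =>
        obtain ⟨x', hx'⟩ := hx
        obtain ⟨y', hy'⟩ := hy
        exact ⟨x' + y', by rw [smul_add, map_add, hx', hy']⟩
      | hsmul t x =>
        refine ⟨(η a * t * η a) • x, ?_⟩
        rw [← mul_smul, hexp, Finset.sum_eq_single a _ (by simp)]
        · have := (InducedModule.ι S M).map_smul ⟨_, hdiag a t⟩ (η a • x)
          simp only [Subalgebra.smul_def] at this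
          rw [← this, ← mul_smul, mul_assoc, (hη.idem a).eq]
        · intro d _ hd
          rcases lt_or_gt_of_ne hd with h | h
          · rw [htri a d h, zero_smul]
          · rw [hM d (by have : (a : ℕ) < d := h; omega), map_zero, smul_zero]
    rintro a ha ⟨x, hx⟩
    obtain ⟨y, hy⟩ := htop a ha x
    have hy0 : y = 0 := by
      have := congrArg (InducedModule.counit S M) hy
      rw [map_smul, InducedModule.counit_ι] at this
      rw [← this, show InducedModule.counit S M x = 0 from hx, smul_zero]
    refine Subtype.ext ?_
    change η a • x = 0
    rw [hy, hy0, map_zero]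

end InducedModule

/-! ### Levels of idempotents and averaging of sections -/

section Idempotents

variable {k : Type u} {T : Type u₁} [Field k] [Ring T] [Algebra k T]

/-- Sums of the members of a complete orthogonal family of idempotents over the fibres of a map
are again a complete orthogonal family of idempotents. -/
theorem CompleteOrthogonalIdempotents.sum_fiber {P Q : Type*} [Fintype P] [Fintype Q]
    [DecidableEq Q] {ε : P → T} (hε : CompleteOrthogonalIdempotents ε) (h : P → Q) :
    CompleteOrthogonalIdempotents fun a => ∑ p with h p = a, ε p := by
  classical
  refine CompleteOrthogonalIdempotents.mk ⟨fun a => ?_, fun a b hab => ?_⟩ ?_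
  · change (∑ p with h p = a, ε p) * (∑ p with h p = a, ε p) = _
    simp only [Finset.sum_mul_sum]
    refine Finset.sum_congr rfl fun p hp => ?_
    rw [Finset.sum_eq_single p, (hε.idem p).eq]
    · exact fun q _ hq => hε.ortho hq.symm
    · exact fun hp' => (hp' hp).elim
  · simp only [Finset.sum_mul_sum]
    refine Finset.sum_eq_zero fun p hp => Finset.sum_eq_zero fun q hq => hε.ortho ?_
    rintro rfl
    simp only [Finset.mem_filter] at hp hq
    exact hab (hp.2.symm.trans hq.2)
  · rw [Finset.sum_fiberwise, hε.complete]

/-- A triangular algebra, relative to a subalgebra that contains the diagonal corners. -/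
theorem hasRelResolution_of_weight {P : Type*} [Fintype P] {m : ℕ} {ε : P → T}
    (hε : CompleteOrthogonalIdempotents ε) (h : P → Fin (m + 1)) (S : Subalgebra k T)
    (htri : ∀ p q, p ≠ q → h q ≤ h p → ∀ t, ε p * t * ε q = 0)
    (hdiag : ∀ p t, ε p * t * ε p ∈ S) (M : ModuleCat.{max u₁ w} T) : HasRelResolution S M m := by
  have key : ∀ a b t, (∑ p with h p = a, ε p) * t * (∑ p with h p = b, ε p) =
      ∑ p with h p = a, ∑ q with h q = b, ε p * t * ε q := fun a b t => by
    simp only [Finset.sum_mul, Finset.mul_sum]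
    exact Finset.sum_comm
  refine hasRelResolution_of_triangular (hε.sum_fiber h) S (fun a b hab t => ?_)
    (fun a t => ?_) m M fun a ha => absurd a.2 (by omega)
  · rw [key]
    refine Finset.sum_eq_zero fun p hp => Finset.sum_eq_zero fun q hq => ?_
    simp only [Finset.mem_filter, Finset.mem_univ, true_and] at hp hq
    subst hp hq
    exact htri p q (by rintro rfl; exact lt_irrefl _ hab) hab.le t
  · rw [key]
    refine Subalgebra.sum_mem _ fun p hp => Subalgebra.sum_mem _ fun q hq => ?_
    simp only [Finset.mem_filter, Finset.mem_univ, true_and] at hp hq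
    -- Distinct idempotents of equal weight have no component between them, so the corner of a whole
    -- level is the sum of the single corners.
    by_cases hpq : p = q
    · exact hpq ▸ hdiag p t
    · rw [htri p q hpq (by rw [hp, hq])]
      exact S.zero_mem

/-- If the larger subalgebra is generated by orthogonal idempotents and by elements of the smaller
one that are homogeneous for these, then sections can be averaged. -/
theorem IsRelProjective.of_homogeneous_generators {P : Type*} [Fintype P] {ε : P → T}
    (hε : CompleteOrthogonalIdempotents ε) {S S' : Subalgebra k T} {G : Set T}
    (hS : S ≤ Algebra.adjoin k (Set.range ε ∪ G)) (hG : G ⊆ S')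
    (hhom : ∀ g ∈ G, ∀ p q, ε p * g * ε q = 0 ∨ g * ε q = ε p * g)
    {M : ModuleCat.{w} T} (hM : IsRelProjective S M) : IsRelProjective S' M := by
  classical
  rintro N f hf ⟨s, hs⟩
  refine hM N f hf ?_
  -- The idempotents need not lie in `S'`, so `s` need not commute with them; the average `∑ ε p s ε
  -- p` does, and is still a section because `f` is `T`-linear.
  let s' : M →+ N := ∑ p, ((DistribSMul.toAddMonoidHom _ (ε p)).comp
    ((s : M →+ N).comp (DistribSMul.toAddMonoidHom _ (ε p))))
  have hs' : ∀ x, s' x = ∑ p, ε p • s (ε p • x) := fun x => by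
    simp [s', AddMonoidHom.finsetSum_apply]
  have hsum : ∀ {X : ModuleCat.{w} T} (x : X), ∑ p, ε p • x = x := fun x => by
    rw [← Finset.sum_smul, hε.complete, one_smul]
  have hgen : ∀ t ∈ Algebra.adjoin k (Set.range ε ∪ G), ∀ x, s' (t • x) = t • s' x := by
    intro t ht
    induction ht using Algebra.adjoin_induction with
    | mem t ht =>
      intro x
      rcases ht with ⟨r, rfl⟩ | ht
      · rw [hs', hs', Finset.smul_sum, Finset.sum_eq_single r _ (by simp),
          Finset.sum_eq_single r _ (by simp)]
        · rw [← mul_smul, ← mul_smul, (hε.idem r).eq]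
        · intro p _ hp
          rw [← mul_smul, hε.ortho hp.symm, zero_smul]
        · intro p _ hp
          rw [← mul_smul, hε.ortho hp, zero_smul, map_zero, smul_zero]
      · have hlin : ∀ y, s (t • y) = t • s y := fun y => s.map_smul ⟨t, hG ht⟩ y
        have h1 : ∀ p, ε p • s (ε p • t • x) = ∑ q, ε p • s (ε p • t • ε q • x) := fun p => by
          conv_lhs => rw [← hsum x]
          simp only [Finset.smul_sum, map_sum]
        have h2 : ∀ q, t • ε q • s (ε q • x) = ∑ p, ε p • t • ε q • s (ε q • x) := fun q =>
          (hsum _).symm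
        -- Both sides become double sums over `(p, q)`. Homogeneity makes each pair of terms either
        -- zero or movable past `s`, which commutes with `t ∈ S'`.
        rw [hs', hs', Finset.smul_sum, Finset.sum_congr rfl fun p _ => h1 p,
          Finset.sum_congr rfl fun q _ => h2 q, Finset.sum_comm]
        refine Finset.sum_congr rfl fun q _ => Finset.sum_congr rfl fun p _ => ?_
        rcases hhom t ht p q with h | h
        · simp only [← mul_smul, ← mul_assoc, h, zero_smul, map_zero, smul_zero]
        · have h3 : ε p • t • ε q • x = t • ε q • x := by
            simp only [← mul_smul, ← mul_assoc]
            rw [← h, mul_assoc, (hε.idem q).eq]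
          have h4 : ε p • t • ε q • s (ε q • x) = ε p • t • s (ε q • x) := by
            simp only [← mul_smul, ← mul_assoc]
            rw [mul_assoc, h, ← mul_assoc, (hε.idem p).eq]
          rw [h3, h4, hlin]
    | algebraMap c =>
      intro x
      rw [hs', hs', Finset.smul_sum]
      refine Finset.sum_congr rfl fun p _ => ?_
      have hlin : ∀ y, s (algebraMap k T c • y) = algebraMap k T c • s y := fun y =>
        s.map_smul ⟨algebraMap k T c, S'.algebraMap_mem c⟩ y
      rw [← mul_smul, ← Algebra.commutes, mul_smul, hlin, ← mul_smul, ← mul_smul,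
        Algebra.commutes]
    | add t t' _ _ h h' => intro x; rw [add_smul, add_smul, map_add, h, h']
    | mul t t' _ _ h h' => intro x; rw [mul_smul, mul_smul, h, h']
  refine ⟨{ s' with map_smul' := fun t x => hgen t (hS t.2) x }, fun x => ?_⟩
  change f (s' x) = x
  rw [hs', map_sum]
  conv_rhs => rw [← hsum x]
  refine Finset.sum_congr rfl fun p _ => ?_
  rw [map_smul, hs, ← mul_smul, (hε.idem p).eq]

end Idempotents

/-! ### The enveloping algebra of a triangular algebra -/

section Enveloping

open MulOpposite

variable {k : Type u} {A : Type u₁} [Field k] [Ring A] [Algebra k A]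

theorem Subalgebra.enveloping_eq_sup (B : Subalgebra k A) :
    B.enveloping = B.map Algebra.TensorProduct.includeLeft ⊔
      B.op.map Algebra.TensorProduct.includeRight := by
  rw [Subalgebra.enveloping, Algebra.TensorProduct.map_range, AlgHom.range_comp, AlgHom.range_comp,
    Subalgebra.range_val, Subalgebra.range_val]

theorem Subalgebra.tmul_mem_enveloping {B : Subalgebra k A} {a b : A} (ha : a ∈ B) (hb : b ∈ B) :
    a ⊗ₜ[k] op b ∈ B.enveloping :=
  ⟨(⟨a, ha⟩ : B) ⊗ₜ[k] (⟨op b, hb⟩ : B.op), rfl⟩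

theorem Subalgebra.enveloping_mono {B C : Subalgebra k A} (h : B ≤ C) :
    B.enveloping ≤ C.enveloping := by
  rw [enveloping_eq_sup, enveloping_eq_sup]
  exact sup_le_sup (Subalgebra.map_mono h)
    (Subalgebra.map_mono fun a ha => h ha)

variable {V : Type u₂} [Fintype V] {e : V → A}

theorem CompleteOrthogonalIdempotents.enveloping (he : CompleteOrthogonalIdempotents e) :
    CompleteOrthogonalIdempotents fun p : V × V => (e p.1 ⊗ₜ[k] op (e p.2) : Enveloping k A) := by
  refine CompleteOrthogonalIdempotents.mk ⟨fun p => ?_, fun p q hpq => ?_⟩ ?_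
  · change (e p.1 ⊗ₜ[k] op (e p.2) : Enveloping k A) * (e p.1 ⊗ₜ[k] op (e p.2)) = _
    rw [Algebra.TensorProduct.tmul_mul_tmul, ← op_mul, (he.idem _).eq, (he.idem _).eq]
  · change (e p.1 ⊗ₜ[k] op (e p.2) : Enveloping k A) * (e q.1 ⊗ₜ[k] op (e q.2)) = 0
    rw [Algebra.TensorProduct.tmul_mul_tmul, ← op_mul]
    by_cases h : p.1 = q.1
    · have h' : p.2 ≠ q.2 := fun h' => hpq (Prod.ext h h')
      rw [he.ortho h'.symm, op_zero, TensorProduct.tmul_zero]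
    · rw [he.ortho h, TensorProduct.zero_tmul]
  · rw [Fintype.sum_prod_type]
    simp only [← TensorProduct.tmul_sum, ← TensorProduct.sum_tmul, ← Finset.op_sum, he.complete]
    rfl

/-- The bound for the relative global dimension of enveloping algebras, for an algebra `A` that is
triangular with respect to `n` idempotents. -/
theorem relGlobalDim_enveloping_le (he : CompleteOrthogonalIdempotents e) (n : ℕ) (hn : 1 ≤ n)
    (label : V ≃ Fin n) (htri : ∀ x y, label x < label y → ∀ a, e y * a * e x = 0)
    (B : Subalgebra k A) (G : Set A) (hG : G ⊆ B)
    (hhom : ∀ β ∈ G, ∃ x y, β = e y * β * e x)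
    (hB : B ≤ Algebra.adjoin k (Set.range e ∪ G))
    (hdiag : ∀ x a, e x * a * e x ∈ Algebra.adjoin k (Set.range e ∪ G)) :
    relGlobalDim.{u, u₁, max u₁ w} B.enveloping ≤ ((2 * n - 2 : ℕ) : ℕ∞) := by
  classical
  refine iSup_le fun M => iInf₂_le (2 * n - 2) ?_
  set C := Algebra.adjoin k (Set.range e ∪ G) with hC
  have hε : CompleteOrthogonalIdempotents
      fun p : V × V => (e p.1 ⊗ₜ[k] op (e p.2) : Enveloping k A) := he.enveloping
  -- The resolution is built over the larger `C.enveloping`, where the diagonal corners are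
  -- available, and then descends to `B.enveloping`.
  refine HasRelResolution.mono (S := C.enveloping) (Subalgebra.enveloping_mono hB) (fun P hP => ?_)
    (hasRelResolution_of_weight hε
      -- The opposite factor reverses the order, hence the reversed second label. The values run
      -- from `0` to `2n - 2`.
      (fun p => ⟨label p.1 + (n - 1 - label p.2), by omega⟩) _ ?_ ?_ M)
  · refine hP.of_homogeneous_generators hε (G := (fun g => g ⊗ₜ[k] 1) '' G ∪
      (fun g => 1 ⊗ₜ[k] op g) '' G) ?_ ?_ ?_
    · rw [Subalgebra.enveloping_eq_sup]
      have hL : ∀ x, (e x ⊗ₜ[k] 1 : Enveloping k A) = ∑ y, e x ⊗ₜ[k] op (e y) := fun x => by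
        rw [← TensorProduct.tmul_sum, ← Finset.op_sum, he.complete, op_one]
      have hR : ∀ x, (1 ⊗ₜ[k] op (e x) : Enveloping k A) = ∑ y, e y ⊗ₜ[k] op (e x) := fun x => by
        rw [← TensorProduct.sum_tmul, he.complete]
      refine sup_le ?_ ?_
      · rw [hC, AlgHom.map_adjoin]
        refine Algebra.adjoin_le ?_
        rintro _ ⟨_, ⟨x, rfl⟩ | hg, rfl⟩
        · rw [Algebra.TensorProduct.includeLeft_apply, hL]
          exact Subalgebra.sum_mem _ fun y _ => Algebra.subset_adjoin (Or.inl ⟨(x, y), rfl⟩)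
        · exact Algebra.subset_adjoin (Or.inr (Or.inl ⟨_, hg, rfl⟩))
      · rw [hC, Subalgebra.op_adjoin, AlgHom.map_adjoin]
        refine Algebra.adjoin_le ?_
        rintro _ ⟨g, ⟨x, hx⟩ | hg, rfl⟩
        · obtain rfl : g = op (e x) := by rw [hx, op_unop]
          rw [Algebra.TensorProduct.includeRight_apply, hR]
          exact Subalgebra.sum_mem _ fun y _ => Algebra.subset_adjoin (Or.inl ⟨(y, x), rfl⟩)
        · exact Algebra.subset_adjoin (Or.inr (Or.inr ⟨_, hg, rfl⟩))
    · rintro _ (⟨g, hg, rfl⟩ | ⟨g, hg, rfl⟩)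
      · exact Subalgebra.tmul_mem_enveloping (b := 1) (hG hg) B.one_mem
      · exact Subalgebra.tmul_mem_enveloping B.one_mem (hG hg)
    -- Each `g` sits in a single corner, so a component of it is zero or all of `g`.
    · have hzero : ∀ g ∈ G, ∀ x y, e y * g * e x = 0 ∨ (e y * g = g ∧ g * e x = g) := by
        intro g hg x y
        obtain ⟨x', y', h⟩ := hhom g hg
        by_cases hx : x' = x
        · by_cases hy : y' = y
          · subst hx hy
            right
            constructor
            · rw [h, ← mul_assoc, ← mul_assoc, (he.idem _).eq]
            · rw [h, mul_assoc, (he.idem _).eq]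
          · left
            rw [h, ← mul_assoc, ← mul_assoc, he.ortho (Ne.symm hy), zero_mul, zero_mul, zero_mul]
        · left
          rw [h, mul_assoc, mul_assoc, he.ortho hx, mul_zero, mul_zero]
      rintro _ (⟨g, hg, rfl⟩ | ⟨g, hg, rfl⟩) ⟨x, y⟩ ⟨x', y'⟩
      · simp only [Algebra.TensorProduct.tmul_mul_tmul, mul_one, one_mul, ← op_mul]
        by_cases hy : y' = y
        · subst hy
          rcases hzero g hg x' x with h | ⟨h, h'⟩
          · left; rw [h, TensorProduct.zero_tmul]
          · right; rw [h, h']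
        · left; rw [he.ortho hy, op_zero, TensorProduct.tmul_zero]
      · simp only [Algebra.TensorProduct.tmul_mul_tmul, mul_one, one_mul, ← op_mul, ← mul_assoc]
        by_cases hx : x = x'
        · subst hx
          rcases hzero g hg y y' with h | ⟨h, h'⟩
          · left; rw [h, op_zero, TensorProduct.tmul_zero]
          · right; rw [h, h']
        · left; rw [he.ortho hx, TensorProduct.zero_tmul]
  · rintro ⟨x, y⟩ ⟨x', y'⟩ hne hle t
    -- If both inequalities fail, the weight comparison forces equal labels in both coordinates,
    -- contradicting `hne`.
    have hcases : label x' < label x ∨ label y < label y' := by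
      by_contra! hcon
      have h₁ : (label x : ℕ) ≤ label x' := hcon.1
      have h₂ : (label y' : ℕ) ≤ label y := hcon.2
      have h₃ : (label x' : ℕ) + (n - 1 - label y') ≤ label x + (n - 1 - label y) := hle
      refine hne (Prod.ext (label.injective (Fin.ext ?_)) (label.injective (Fin.ext ?_))) <;>
        dsimp only <;> omega
    induction t using TensorProduct.induction_on with
    | zero => rw [mul_zero, zero_mul]
    | add t t' h h' => rw [mul_add, add_mul, h, h', add_zero]
    | tmul a b =>
      obtain ⟨b, rfl⟩ := op_surjective b
      simp only [Algebra.TensorProduct.tmul_mul_tmul, ← op_mul]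
      rcases hcases with h | h
      · rw [htri _ _ h, TensorProduct.zero_tmul]
      · rw [← mul_assoc, htri _ _ h, op_zero, TensorProduct.tmul_zero]
  · rintro ⟨x, y⟩ t
    induction t using TensorProduct.induction_on with
    | zero => rw [mul_zero, zero_mul]; exact Subalgebra.zero_mem _
    | add t t' h h' => rw [mul_add, add_mul]; exact Subalgebra.add_mem _ h h'
    | tmul a b =>
      obtain ⟨b, rfl⟩ := op_surjective b
      simp only [Algebra.TensorProduct.tmul_mul_tmul, ← op_mul]
      refine Subalgebra.tmul_mem_enveloping (hdiag x a) ?_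
      rw [← mul_assoc]
      exact hdiag y b

end Enveloping

/-! ### Corners of `kQ/I` and the final bound -/

namespace PathAlgebra

section Vertices

variable {k : Type u} {V : Type u₁} [Field k] [Quiver.{v} V]

theorem vertex_mul_vertex_self (x : V) : (vertex x * vertex x : PathAlgebra k V) = vertex x := by
  simp [vertex, ofPath_mul_ofPath, pathMul]

theorem vertex_mul_vertex_of_ne {x y : V} (h : x ≠ y) :
    (vertex x * vertex y : PathAlgebra k V) = 0 := by
  simp [vertex, ofPath_mul_ofPath, pathMul, h]

theorem arrow_mul_ofPath {x y z : V} (a : y ⟶ z) (q : Quiver.Path x y) :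
    (arrow a * ofPath ⟨x, y, q⟩ : PathAlgebra k V) = ofPath ⟨x, z, q.cons a⟩ := by
  simp [arrow, ofPath_mul_ofPath, pathMul, Quiver.Hom.toPath]

theorem label_le_of_path {n : ℕ} {label : V → Fin n}
    (hQ : ∀ x y : V, label x < label y → IsEmpty (x ⟶ y)) {x y : V} (q : Quiver.Path x y) :
    label y ≤ label x := by
  induction q with
  | nil => exact le_rfl
  | cons q a ih => exact le_trans (not_lt.1 fun h => (hQ _ _ h).false a) ih

end Vertices

variable {k : Type u} {V : Type u₁} [Field k] [Quiver.{v} V] [Fintype V]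

theorem vertex_mul_mul_vertex_mem_span (x y : V) (f : PathAlgebra k V) :
    vertex y * f * vertex x ∈
      Submodule.span k (Set.range fun q : Quiver.Path x y =>
        (ofPath ⟨x, y, q⟩ : PathAlgebra k V)) := by
  induction f using induction_on with
  | h0 => rw [mul_zero, zero_mul]; exact Submodule.zero_mem _
  | hadd f g hf hg => rw [mul_add, add_mul]; exact Submodule.add_mem _ hf hg
  | hsmul c p =>
    rw [mul_smul_comm, smul_mul_assoc]
    refine Submodule.smul_mem _ c ?_
    obtain ⟨a, b, p⟩ := p
    by_cases hb : y = b
    · subst hb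
      have h : (vertex y * ofPath ⟨a, y, p⟩ : PathAlgebra k V) = ofPath ⟨a, y, p⟩ := by
        simp [vertex, ofPath_mul_ofPath, pathMul]
      rw [h]
      by_cases ha : a = x
      · subst ha
        have h : (ofPath ⟨a, y, p⟩ * vertex a : PathAlgebra k V) = ofPath ⟨a, y, p⟩ := by
          simp [vertex, ofPath_mul_ofPath, pathMul]
        rw [h]
        exact Submodule.subset_span ⟨p, rfl⟩
      · have h : (ofPath ⟨a, y, p⟩ * vertex x : PathAlgebra k V) = 0 := by
          simp [vertex, ofPath_mul_ofPath, pathMul, ha]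
        rw [h]
        exact Submodule.zero_mem _
    · have h : (vertex y * ofPath ⟨a, b, p⟩ : PathAlgebra k V) = 0 := by
        simp [vertex, ofPath_mul_ofPath, pathMul, hb]
      rw [h, zero_mul]
      exact Submodule.zero_mem _

variable (I : TwoSidedIdeal (PathAlgebra k V))

theorem completeOrthogonalIdempotents_boundVertex :
    CompleteOrthogonalIdempotents (boundVertex I) := by
  refine CompleteOrthogonalIdempotents.mk ⟨fun x => ?_, fun x y h => ?_⟩ ?_
  · exact (map_mul I.ringCon.mk' _ _).symm.trans (congrArg _ (vertex_mul_vertex_self x))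
  · exact ((map_mul I.ringCon.mk' _ _).symm.trans
      (congrArg _ (vertex_mul_vertex_of_ne h))).trans (map_zero _)
  · exact (map_sum I.ringCon.mk' _ _).symm.trans (map_one I.ringCon.mk')

theorem mk'_smul (c : k) (f : PathAlgebra k V) :
    I.ringCon.mk' (c • f) = c • (I.ringCon.mk' f : Bound I) := rfl

/-- Reduces a claim about a corner to single paths. It serves twice: with `W = ⊥` for triangularity,
and with a subalgebra for the diagonal corners. -/
theorem boundVertex_mul_mul_boundVertex_mem {x y : V} (W : Submodule k (Bound I))
    (hW : ∀ q : Quiver.Path x y, I.ringCon.mk' (ofPath ⟨x, y, q⟩) ∈ W) (a : Bound I) :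
    boundVertex I y * a * boundVertex I x ∈ W := by
  obtain ⟨f, rfl⟩ := I.ringCon.mk'_surjective a
  have : boundVertex I y * I.ringCon.mk' f * boundVertex I x =
      I.ringCon.mk' (vertex y * f * vertex x) := by
    rw [map_mul, map_mul]; rfl
  rw [this]
  have hspan := vertex_mul_mul_vertex_mem_span x y f
  generalize vertex y * f * vertex x = g at hspan
  induction hspan using Submodule.span_induction with
  | mem f hf => obtain ⟨q, rfl⟩ := hf; exact hW q
  | zero => rw [map_zero]; exact W.zero_mem
  | add f g _ _ hf hg => rw [map_add]; exact W.add_mem hf hg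
  | smul c f _ hf => rw [mk'_smul]; exact W.smul_mem c hf

/-- Labels never increase along a path, so the hypothesis on its ends makes them constant; as
`label` is injective, every arrow of the path is a loop. -/
theorem mk'_ofPath_mem {n : ℕ} (label : V ≃ Fin n)
    (hQ : ∀ x y : V, label x < label y → IsEmpty (x ⟶ y)) (C : Subalgebra k (Bound I))
    (hvertex : ∀ x, boundVertex I x ∈ C) (hloop : ∀ (x : V) (a : x ⟶ x), boundArrow I a ∈ C)
    {x y : V} (q : Quiver.Path x y) (hxy : label x ≤ label y) :
    I.ringCon.mk' (ofPath ⟨x, y, q⟩) ∈ C := by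
  induction q with
  | nil => exact hvertex x
  | @cons z y q a ih =>
    have h₁ : label y ≤ label z := not_lt.1 fun h => (hQ _ _ h).false a
    obtain rfl : y = z :=
      label.injective (le_antisymm h₁ ((label_le_of_path hQ q).trans hxy))
    rw [← arrow_mul_ofPath, map_mul]
    exact C.mul_mem (hloop y a) (ih hxy)

end PathAlgebra

open PathAlgebra

theorem mainTheorem6 {k : Type u} [Field k] [IsAlgClosed k] (n : ℕ) (hn : 1 ≤ n)
    {V : Type u₁} [Fintype V] [Quiver.{v} V] (label : V ≃ Fin n)
    (hQ : ∀ x y : V, label x < label y → IsEmpty (x ⟶ y))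
    (I : TwoSidedIdeal (PathAlgebra k V)) (hI : PathAlgebra.IsAdmissible I)
    (R : QuiverElements (PathAlgebra.Bound I)) (hR : R.IsCompatible)
    (B : Subalgebra k (PathAlgebra.Bound I)) (hB : B.IsConjugateTo (R.subalgebra k)) :
    relGlobalDim.{u, max u u₁ v, max u u₁ v w} B.enveloping ≤ ((2 * n - 2 : ℕ) : ℕ∞) := by
  obtain ⟨z, hz⟩ := hB
  -- Conjugation by `z` is applied to the vertices and to the arrows of `R`, so `B` itself stays
  -- fixed and the general bound applies to the conjugated idempotents.
  let φ : Bound I ≃ₐ[k] Bound I := MulSemiringAction.toAlgEquiv k (Bound I) (ConjAct.toConjAct z)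
  have hφ : ∀ a, φ a = ↑z * a * ↑z⁻¹ := fun a => rfl
  have he := completeOrthogonalIdempotents_boundVertex I
  have hBmap : B = (R.subalgebra k).map φ.toAlgHom := by
    ext b
    rw [hz, Subalgebra.mem_map]
    exact ⟨fun ⟨c, hc, h⟩ => ⟨c, hc, h.symm⟩, fun ⟨c, hc, h⟩ => ⟨c, hc, h.symm⟩⟩
  have hC : Algebra.adjoin k (Set.range (φ ∘ boundVertex I) ∪ φ '' R.arrows) =
      (Algebra.adjoin k (Set.range (boundVertex I) ∪ R.arrows)).map φ.toAlgHom := by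
    rw [AlgHom.map_adjoin, Set.range_comp, ← Set.image_union]
    rfl
  have hvertex : ∀ x, boundVertex I x ∈
      Algebra.adjoin k (Set.range (boundVertex I) ∪ R.arrows) :=
    fun x => Algebra.subset_adjoin (Or.inl ⟨x, rfl⟩)
  refine relGlobalDim_enveloping_le.{u, max u u₁ v, u₁, w} (e := φ ∘ boundVertex I)
    (he.map φ.toAlgHom.toRingHom) n hn label ?_ B (φ '' R.arrows) ?_ ?_ ?_ ?_
  · intro x y hxy a
    obtain ⟨a, rfl⟩ := φ.surjective a
    rw [Function.comp_apply, Function.comp_apply, ← map_mul, ← map_mul,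
      EmbeddingLike.map_eq_zero_iff]
    refine (Submodule.mem_bot k).1 (boundVertex_mul_mul_boundVertex_mem I ⊥ (fun q => ?_) a)
    exact absurd (label_le_of_path hQ q) (not_le.2 hxy)
  · rintro _ ⟨g, hg, rfl⟩
    rw [hBmap]
    exact ⟨g, Algebra.subset_adjoin (Or.inr hg), rfl⟩
  · rintro _ ⟨g, hg, rfl⟩
    obtain ⟨x, y, h⟩ := hR.arrows_eq g hg
    refine ⟨x, y, ?_⟩
    rw [Function.comp_apply, Function.comp_apply, ← map_mul, ← map_mul, ← h]
  -- Vertices of `R` are only sums of vertices of `Q`, so `B` may be strictly smaller than the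
  -- algebra generated by all vertices and the arrows of `R`.
  · rw [hBmap, hC]
    refine Subalgebra.map_mono (Algebra.adjoin_le ?_)
    rintro r (hr | hr)
    · obtain ⟨s, rfl⟩ := hR.vertices_eq r hr
      exact Subalgebra.sum_mem _ fun x _ => hvertex x
    · exact Algebra.subset_adjoin (Or.inr hr)
  · intro x a
    obtain ⟨a, rfl⟩ := φ.surjective a
    rw [hC, Function.comp_apply, ← map_mul, ← map_mul]
    refine ⟨_, ?_, rfl⟩
    exact boundVertex_mul_mul_boundVertex_mem I (Subalgebra.toSubmodule
        (Algebra.adjoin k (Set.range (boundVertex I) ∪ R.arrows)))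
      (fun q => mk'_ofPath_mem I label hQ _ hvertex
        (fun x a => Algebra.subset_adjoin (Or.inr (hR.loops_mem x a))) q le_rfl) a
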